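/- Assume the Continuum Hypothesis, $2^{\aleph_0}=\aleph_1$. Let $\mathbb{Z}(2)=\mathbb{Z}/2\mathbb{Z}$ carry the discrete topology and let $\mathbb{Z}(2)^{\omega_1}$ carry the product topology and the coordinatewise group operation. Then there exists a subgroup $G$ of $\mathbb{Z}(2)^{\omega_1}$ which, with the subspace topology, is a separable countably compact (Hausdorff) topological abelian group, and which contains a closed subgroup $K$ (closed in $G$) that is not separable. In particular, under CH there exists a separable countably compact topological abelian group with a closed non-separable subgroup. -/

import Mathlib

open Set Filter Topology

/-! Fix countably many coordinates `b`; call `x ∘ b` the trace of `x`. `G` consists of the `x` equal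
to `Φ (x ∘ b)` off a countable set. Traceless members of `G` have countable support and form `K`, so
a countable subset of `K` vanishes at a common coordinate where some member of `K` does not. CH
lists all sequences of traces in type `ω₁`; a recursion on coordinates makes `Φ` so generic that
along any injective sequence its values cluster at every point prescribed on a suitable countable
set. This yields both countable compactness and separability of `G`. -/

/-- Well-founded recursion: a family can be chosen so that each member satisfies a prescribed
relation to the members below it. -/
theorem exists_fun_of_forall_lt {I C : Type*} [LT I] [WellFoundedLT I]
    (P : (x : I) → ((y : I) → y < x → C) → C → Prop) (h : ∀ x g, ∃ c, P x g c) :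
    ∃ φ : I → C, ∀ x, P x (fun y _ => φ y) (φ x) := by
  choose c hc using h
  refine ⟨WellFoundedLT.fix c, fun x => ?_⟩
  have := hc x (fun y _ => WellFoundedLT.fix c y)
  rwa [← WellFoundedLT.fix_eq c x] at this

theorem linearIndependent_of_notMem_span_Iio {K V : Type*} [DivisionRing K] [AddCommGroup V]
    [Module K V] {v : ℕ → V} (hv : ∀ n, v n ∉ Submodule.span K (v '' Iio n)) :
    LinearIndependent K v := by
  have key : ∀ n, LinearIndepOn K v (Iio n) := by
    intro n
    induction n with
    | zero => simp
    | succ n ih =>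
      have : Iio (n + 1) = insert n (Iio n) := by ext; simp
      rw [this]
      exact ih.insert (hv n)
  rw [← linearIndepOn_univ_iff]
  have : (univ : Set ℕ) = ⋃ n, Iio n := by
    ext n; simp
  rw [this]
  exact linearIndepOn_iUnion_of_directed
    (directed_of_isDirected_le fun a b hab => Iio_subset_Iio hab) key

theorem LinearIndependent.exists_linearMap_apply_eq {ι K V W : Type*} [DivisionRing K]
    [AddCommGroup V] [Module K V] [AddCommGroup W] [Module K W] {v : ι → V}
    (hv : LinearIndependent K v) (w : ι → W) : ∃ f : V →ₗ[K] W, ∀ i, f (v i) = w i := by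
  obtain ⟨f, hf⟩ := LinearMap.exists_extend ((Module.Basis.span hv).constr ℕ w)
  refine ⟨f, fun i => ?_⟩
  have h := LinearMap.congr_fun hf (Module.Basis.span hv i)
  rw [Module.Basis.constr_basis] at h
  rw [← h]
  simp [Module.Basis.span_apply]

/-! ### Generic functionals -/

/-- A single linear functional over `𝔽₂` splits each of countably many infinite sets into two
infinite pieces. -/
theorem exists_functional_splitting {J V : Type*} [Countable J] [AddCommGroup V]
    [Module (ZMod 2) V] (A : J → Set V) :
    ∃ f : V →ₗ[ZMod 2] ZMod 2, ∀ j, (A j).Infinite → ∀ c, {v ∈ A j | f v = c}.Infinite := by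
  rcases isEmpty_or_nonempty {j // (A j).Infinite} with hJ | hJ
  · exact ⟨0, fun j hj => (hJ.false ⟨j, hj⟩).elim⟩
  -- The factor `ℕ` makes each pair (set, value) recur infinitely often. Finite sets have finite
  -- span over `𝔽₂`, so an independent choice is always possible.
  obtain ⟨e, he⟩ := exists_surjective_nat ({j // (A j).Infinite} × ZMod 2 × ℕ)
  obtain ⟨v, hv⟩ := exists_fun_of_forall_lt
    (fun (n : ℕ) (g : ∀ m, m < n → V) (x : V) => x ∈ A (e n).1 ∧
      x ∉ Submodule.span (ZMod 2) (range fun m : Iio n => g m m.2)) (by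
    intro n g
    have hfin : (Submodule.span (ZMod 2) (range fun m : Iio n => g m m.2) : Set V).Finite := by
      have : Module.Finite (ZMod 2)
          (Submodule.span (ZMod 2) (range fun m : Iio n => g m m.2)) :=
        Module.Finite.span_of_finite _ (finite_range _)
      exact @Set.toFinite _ _ (Module.finite_of_finite (ZMod 2))
    obtain ⟨x, hx, hx'⟩ := ((e n).1.2.sdiff hfin).nonempty
    exact ⟨x, hx, hx'⟩)
  have hli : LinearIndependent (ZMod 2) v := by
    refine linearIndependent_of_notMem_span_Iio fun n => ?_
    rw [image_eq_range]
    exact (hv n).2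
  obtain ⟨f, hf⟩ := hli.exists_linearMap_apply_eq fun n => (e n).2.1
  refine ⟨f, fun j hj c => ?_⟩
  refine infinite_of_injective_forall_mem (f := fun k : ℕ =>
    v (Function.surjInv he (⟨j, hj⟩, c, k))) (fun k l hkl => ?_) fun k => ⟨?_, ?_⟩
  · simpa using Function.injective_surjInv he (hli.injective hkl)
  · have := (hv (Function.surjInv he (⟨j, hj⟩, c, k))).1
    rwa [Function.surjInv_eq he] at this
  · rw [hf, Function.surjInv_eq he]

/-- Recursive construction of functionals, each of which splits all infinite sets that are cut out
of the earlier sequences `S η` by finitely many conditions on the earlier functionals. -/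
theorem exists_splitting_family {I V : Type*} [LinearOrder I] [WellFoundedLT I]
    (hI : ∀ i : I, (Iio i).Countable) [AddCommGroup V] [Module (ZMod 2) V] (S : I → ℕ → V) :
    ∃ φ : I → V →ₗ[ZMod 2] ZMod 2, ∀ ξ η, η ≤ ξ → ∀ F : Finset I, (∀ ζ ∈ F, ζ < ξ) →
      ∀ ε : I → ZMod 2, {v ∈ range (S η) | ∀ ζ ∈ F, φ ζ v = ε ζ}.Infinite →
        ∀ c, {v ∈ range (S η) | (∀ ζ ∈ F, φ ζ v = ε ζ) ∧ φ ξ v = c}.Infinite := by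
  obtain ⟨φ, hφ⟩ := exists_fun_of_forall_lt
    (fun (ξ : I) (g : ∀ ζ, ζ < ξ → V →ₗ[ZMod 2] ZMod 2) (f : V →ₗ[ZMod 2] ZMod 2) =>
      ∀ j : Iic ξ × (F : Finset (Iio ξ)) × (F → ZMod 2),
        {v ∈ range (S j.1) | ∀ ζ : j.2.1, g ζ.1 ζ.1.2 v = j.2.2 ζ}.Infinite →
        ∀ c, {v ∈ {v ∈ range (S j.1) | ∀ ζ : j.2.1, g ζ.1 ζ.1.2 v = j.2.2 ζ} |
          f v = c}.Infinite) (by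
    intro ξ g
    have h1 : Countable (Iio ξ) := (hI ξ).to_subtype
    have h2 : Countable (Iic ξ) := by
      rw [← Iio_insert]
      exact ((hI ξ).insert ξ).to_subtype
    exact exists_functional_splitting _)
  refine ⟨φ, fun ξ η hη F hF ε hinf c => ?_⟩
  have heq : ∀ v, (∀ ζ : F.subtype (· ∈ Iio ξ), φ ζ.1 v = ε ζ.1) ↔ ∀ ζ ∈ F, φ ζ v = ε ζ := by
    intro v
    constructor
    · intro h ζ hζ
      exact h ⟨⟨ζ, hF ζ hζ⟩, by simpa using hζ⟩
    · rintro h ⟨ζ, hζ⟩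
      exact h ζ (by simpa using hζ)
  have := hφ ξ (⟨η, hη⟩, ⟨F.subtype (· ∈ Iio ξ), fun ζ => ε ζ.1⟩)
  simp only [heq] at this
  simpa [and_assoc] using this hinf c

theorem mapClusterPt_pi_discrete_iff {I X α : Type*} [TopologicalSpace X] [DiscreteTopology X]
    {l : Filter α} {u : α → I → X} {x : I → X} :
    MapClusterPt x l u ↔ ∀ F : Finset I, ∃ᶠ a in l, ∀ i ∈ F, u a i = x i := by
  rw [mapClusterPt_iff_frequently]
  constructor
  · intro h F
    refine h {y | ∀ i ∈ F, y i = x i} ?_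
    exact (Filter.eventually_all_finset F).2 fun i _ =>
      (continuous_apply i).continuousAt.eventually ((isOpen_discrete {x i}).mem_nhds rfl)
  · intro h s hs
    rw [nhds_pi, mem_pi'] at hs
    obtain ⟨F, t, ht, hts⟩ := hs
    exact (h F).mono fun a ha => hts fun i hi => by
      rw [ha i hi]; exact mem_of_mem_nhds (ht i)

/-- A homomorphism into `2^I` such that the image of every injective sequence is dense in a
translate of a cofinal power of `2`. -/
theorem exists_addHom_mapClusterPt {I V : Type*} [LinearOrder I] [WellFoundedLT I]
    (hI : ∀ i : I, (Iio i).Countable) [AddCommGroup V] [Module (ZMod 2) V] (S : I → ℕ → V)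
    (hS : Function.Surjective S) :
    ∃ Φ : V →+ (I → ZMod 2), ∀ h : ℕ → V, h.Injective →
      ∃ C : Set I, C.Countable ∧ ∃ q, ∀ x, EqOn x q C → MapClusterPt x atTop (Φ ∘ h) := by
  obtain ⟨φ, hφ⟩ := exists_splitting_family hI S
  refine ⟨(LinearMap.pi φ).toAddMonoidHom, fun h hh => ?_⟩
  obtain ⟨η, rfl⟩ := hS h
  obtain ⟨q, hq⟩ : ∃ q, MapClusterPt q atTop ((LinearMap.pi φ).toAddMonoidHom ∘ S η) :=
    exists_clusterPt_of_compactSpace _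
  have hfreq : ∀ (F : Finset I) (x : I → ZMod 2),
      (∃ᶠ n in atTop, ∀ i ∈ F, ((LinearMap.pi φ).toAddMonoidHom ∘ S η) n i = x i) ↔
        {v ∈ range (S η) | ∀ ζ ∈ F, φ ζ v = x ζ}.Infinite := by
    intro F x
    rw [Nat.frequently_atTop_iff_infinite, ← infinite_image_iff hh.injOn]
    congr!
    ext v
    constructor
    · rintro ⟨n, hn, rfl⟩
      exact ⟨mem_range_self n, hn⟩
    · rintro ⟨⟨n, rfl⟩, hn⟩
      exact ⟨n, hn, rfl⟩
  -- Below `η` the values follow a cluster point `q`; from `η` on, splitting lets each coordinate be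
  -- prescribed freely.
  refine ⟨Iio η, hI η, q, fun x hx => ?_⟩
  rw [mapClusterPt_pi_discrete_iff] at hq ⊢
  intro F
  rw [hfreq]
  induction F using Finset.induction_on_max with
  | empty =>
    have := (hfreq ∅ q).1 (hq ∅)
    simpa using this
  | insert a F haF ih =>
    rcases lt_or_ge a η with ha | ha
    · have := (hfreq (insert a F) q).1 (hq _)
      refine this.mono fun v hv => ⟨hv.1, fun ζ hζ => ?_⟩
      rw [hv.2 ζ hζ]
      refine (hx ?_).symm
      rcases Finset.mem_insert.1 hζ with rfl | hζ
      · exact ha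
      · exact (haF ζ hζ).trans ha
    · refine (hφ a η ha F haF x ih (x a)).mono fun v hv => ⟨hv.1, fun ζ hζ => ?_⟩
      rcases Finset.mem_insert.1 hζ with rfl | hζ
      · exact hv.2.2
      · exact hv.2.1 ζ hζ

/-- Any sequence converging in the domain has an image with a cluster point differing from the
image of the limit in countably many coordinates only. -/
theorem exists_mapClusterPt_of_tendsto {I V : Type*} [TopologicalSpace V] [T2Space V]
    {Φ : V → I → ZMod 2} (hΦ : ∀ h : ℕ → V, h.Injective →
      ∃ C : Set I, C.Countable ∧ ∃ q, ∀ x, EqOn x q C → MapClusterPt x atTop (Φ ∘ h))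
    {h : ℕ → V} {v : V} (hv : Tendsto h atTop (𝓝 v)) :
    ∃ q, {i | q i ≠ Φ v i}.Countable ∧ MapClusterPt q atTop (Φ ∘ h) := by
  classical
  by_cases hfin : ∃ᶠ n in atTop, h n = v
  · refine ⟨Φ v, by simp, mapClusterPt_pi_discrete_iff.2 fun F => ?_⟩
    exact hfin.mono fun n hn i _ => by simp [hn]
  · rw [not_frequently] at hfin
    have hev : ∀ N, ∃ n > N, ∀ m ≤ N, h n ≠ v ∧ (h m ≠ v → h n ≠ h m) := by
      intro N
      have h1 : ∀ m ∈ Finset.range (N + 1), ∀ᶠ n in atTop, h m ≠ v → h n ≠ h m := by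
        intro m _
        by_cases hm : h m = v
        · simp [hm]
        · exact (hv.eventually_ne (Ne.symm hm)).mono fun n hn _ => hn
      obtain ⟨n, ⟨hn1, hn2⟩, hn3⟩ := ((hfin.and
        ((Filter.eventually_all_finset _).2 h1)).and (eventually_gt_atTop N)).exists
      exact ⟨n, hn3, fun m hm => ⟨hn1, hn2 m (by simp; omega)⟩⟩
    choose s hs1 hs2 using hev
    let ψ : ℕ → ℕ := fun k => s^[k + 1] 0
    have hψ : ∀ k, ψ (k + 1) = s (ψ k) := fun k => Function.iterate_succ_apply' s _ _
    have hmono : StrictMono ψ := strictMono_nat_of_lt_succ fun k => by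
      rw [hψ]; exact hs1 _
    have hne : ∀ k, h (ψ k) ≠ v := by
      intro k
      have : ψ k = s (s^[k] 0) := Function.iterate_succ_apply' s _ _
      rw [this]
      exact (hs2 _ _ le_rfl).1
    have hinj : Function.Injective (h ∘ ψ) := by
      refine Function.Injective.of_lt_imp_ne fun k l hkl => ?_
      obtain ⟨l, rfl⟩ : ∃ l', l = l' + 1 := ⟨l - 1, by omega⟩
      have := (hs2 (ψ l) (ψ k) (hmono.monotone (by omega))).2 (hne k)
      rw [← hψ] at this
      exact this.symm
    obtain ⟨C, hC, q, hq⟩ := hΦ _ hinj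
    refine ⟨C.piecewise q (Φ v), hC.mono fun i hi => ?_, ?_⟩
    · by_contra hiC
      simp [hiC] at hi
    · exact (hq _ (piecewise_eqOn C q (Φ v))).of_comp hmono.tendsto_atTop

/-! ### The group and its properties -/

/-- The points `x` of `2^I` which, up to countably many coordinates, are the image under `Φ` of
their restriction along `b`. -/
def almostGraph {I : Type*} (b : ℕ → I) (Φ : (ℕ → ZMod 2) →+ (I → ZMod 2)) :
    AddSubgroup (I → ZMod 2) where
  carrier := {x | {i | x i ≠ Φ (x ∘ b) i}.Countable}
  zero_mem' := by
    have : ((0 : I → ZMod 2) ∘ b) = 0 := rfl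
    simp [this]
  add_mem' {x y} hx hy := by
    refine (hx.union hy).mono fun i hi => ?_
    by_contra hc
    simp only [mem_union, mem_ofPred_eq, not_or, not_not] at hc
    have : (x + y) ∘ b = x ∘ b + y ∘ b := rfl
    exact hi (by rw [this, map_add, Pi.add_apply, Pi.add_apply, ← hc.1, ← hc.2])
  neg_mem' {x} hx := by
    refine hx.mono fun i hi => ?_
    by_contra hc
    simp only [mem_ofPred_eq, not_not] at hc
    have : (-x) ∘ b = -(x ∘ b) := rfl
    exact hi (by rw [this, map_neg, Pi.neg_apply, Pi.neg_apply, ← hc])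

theorem mem_almostGraph {I : Type*} {b : ℕ → I} {Φ : (ℕ → ZMod 2) →+ (I → ZMod 2)}
    {x : I → ZMod 2} : x ∈ almostGraph b Φ ↔ {i | x i ≠ Φ (x ∘ b) i}.Countable := Iff.rfl

section

variable {I : Type*} {b : ℕ → I} {Φ : (ℕ → ZMod 2) →+ (I → ZMod 2)}

theorem isCountablyCompact_almostGraph
    (hΦ : ∀ h : ℕ → (ℕ → ZMod 2), h.Injective →
      ∃ C : Set I, C.Countable ∧ ∃ q, ∀ x, EqOn x q C → MapClusterPt x atTop (Φ ∘ h)) :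
    IsCountablyCompact (almostGraph b Φ : Set (I → ZMod 2)) := by
  classical
  refine IsCountablyCompact.of_seq_clusterPt fun g hg => ?_
  obtain ⟨N, hN⟩ := eventually_atTop.1 hg
  let C : Set I := range b ∪ ⋃ n : Ici N, {i | g n i ≠ Φ (g n ∘ b) i}
  -- Since `C` contains `range b`, a limit on `C` already fixes the trace; the values off `C` can
  -- then be taken from `q`.
  have hC : C.Countable := (countable_range b).union (countable_iUnion fun n => hN n n.2)
  have hb : ∀ n, b n ∈ C := fun n => Or.inl (mem_range_self n)
  have hgC : ∀ n ≥ N, ∀ i ∉ C, g n i = Φ (g n ∘ b) i := by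
    intro n hn i hi
    by_contra hne
    exact hi (Or.inr (mem_iUnion.2 ⟨⟨n, hn⟩, hne⟩))
  have : Countable C := hC.to_subtype
  obtain ⟨p, ψ, hψ, hp⟩ := CompactSpace.tendsto_subseq fun n => C.domRestrict (g n)
  let v : ℕ → ZMod 2 := fun n => p ⟨b n, hb n⟩
  have hv : Tendsto (fun n => g (ψ n) ∘ b) atTop (𝓝 v) := by
    rw [tendsto_pi_nhds] at hp ⊢
    exact fun n => hp ⟨b n, hb n⟩
  obtain ⟨q, hq, hq'⟩ := exists_mapClusterPt_of_tendsto hΦ hv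
  let x : I → ZMod 2 := fun i => if hi : i ∈ C then p ⟨i, hi⟩ else q i
  have hxb : x ∘ b = v := by
    ext n
    simp [x, v, hb]
  have hx : x ∈ almostGraph b Φ := by
    rw [mem_almostGraph, hxb]
    refine (hC.union hq).mono fun i hi => ?_
    by_cases hiC : i ∈ C
    · exact Or.inl hiC
    · exact Or.inr (by simpa [x, hiC] using hi)
  refine ⟨x, hx, MapClusterPt.of_comp hψ.tendsto_atTop ?_⟩
  rw [mapClusterPt_pi_discrete_iff] at hq' ⊢
  intro F
  have h1 : ∀ᶠ n in atTop, ∀ i ∈ F, ∀ hi : i ∈ C, g (ψ n) i = p ⟨i, hi⟩ := by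
    refine (Filter.eventually_all_finset F).2 fun i _ => ?_
    by_cases hi : i ∈ C
    · have := (tendsto_pi_nhds.1 hp ⟨i, hi⟩).eventually ((isOpen_discrete {p ⟨i, hi⟩}).mem_nhds rfl)
      exact this.mono fun n hn _ => hn
    · simp [hi]
  refine ((hq' F).and_eventually (h1.and (eventually_ge_atTop N))).mono ?_
  rintro n ⟨hn1, hn2, hn3⟩ i hi
  by_cases hiC : i ∈ C
  · simpa [x, hiC] using hn2 i hi hiC
  · have := hgC (ψ n) (hn3.trans (hψ.id_le n)) i hiC
    simpa [x, hiC, this] using hn1 i hi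

theorem separableSpace_almostGraph (hb : b.Injective)
    (hΦ : ∀ h : ℕ → (ℕ → ZMod 2), h.Injective →
      ∃ C : Set I, C.Countable ∧ ∃ q, ∀ x, EqOn x q C → MapClusterPt x atTop (Φ ∘ h)) :
    TopologicalSpace.SeparableSpace (almostGraph b Φ) := by
  classical
  let d := TopologicalSpace.denseSeq (ℕ → ZMod 2)
  -- For fixed `k` these traces are distinct and converge to `d k`.
  let u : ℕ → ℕ → (ℕ → ZMod 2) := fun k n => d k + Pi.single n 1
  have hu : ∀ k, (u k).Injective := by
    intro k m n hmn
    by_contra hne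
    have := congrFun hmn m
    simp [u, hne] at this
  choose C' hC' q hq using fun k => hΦ (u k) (hu k)
  let C : Set I := range b ∪ ⋃ k, C' k
  have hC : C.Countable := (countable_range b).union (countable_iUnion hC')
  have : Countable C := hC.to_subtype
  have hbC : ∀ n, b n ∈ C := fun n => Or.inl (mem_range_self n)
  -- Only countably many traces occur; values on `C` vary subject to the trace, and off `C` they are
  -- given by `Φ`.
  let Y := {z : (ℕ × ℕ) × (C → ZMod 2) // ∀ n, z.2 ⟨b n, hbC n⟩ = u z.1.1 z.1.2 n}
  have : SecondCountableTopology Y := TopologicalSpace.Subtype.secondCountableTopology _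
  let y : Y → I → ZMod 2 := fun z i =>
    if hi : i ∈ C then z.1.2 ⟨i, hi⟩ else Φ (u z.1.1.1 z.1.1.2) i
  have hyb : ∀ z, y z ∘ b = u z.1.1.1 z.1.1.2 := by
    intro z
    ext n
    simp [y, hbC, z.2 n]
  have hy : ∀ z, y z ∈ almostGraph b Φ := by
    intro z
    rw [mem_almostGraph, hyb]
    refine hC.mono fun i hi => ?_
    by_contra hiC
    simp [y, hiC] at hi
  have hcont : Continuous y := by
    refine continuous_pi fun i => ?_
    by_cases hi : i ∈ C
    · simp only [y, hi, dite_true]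
      fun_prop
    · simp only [y, hi, dite_false]
      exact (continuous_of_discreteTopology (f := fun z : ℕ × ℕ => Φ (u z.1 z.2) i)).comp
        (continuous_fst.comp continuous_subtype_val)
  refine DenseRange.separableSpace (f := fun z : Y => (⟨y z, hy z⟩ : almostGraph b Φ)) ?_
    (hcont.subtype_mk hy)
  rw [DenseRange, IsInducing.subtypeVal.dense_iff]
  rintro ⟨x, -⟩
  rw [← range_comp, mem_closure_iff_nhds]
  intro t ht
  rw [nhds_pi, mem_pi'] at ht
  obtain ⟨F, s, hs, hst⟩ := ht
  let M : Finset ℕ := F.preimage b hb.injOn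
  obtain ⟨k, hk⟩ : ∃ k, ∀ n ∈ M, d k n = x (b n) := by
    have hopen : IsOpen ((M : Set ℕ).pi fun n => {x (b n)}) :=
      isOpen_set_pi M.finite_toSet fun n _ => isOpen_discrete _
    obtain ⟨k, hk⟩ := (TopologicalSpace.denseRange_denseSeq (ℕ → ZMod 2)).exists_mem_open hopen
      ⟨x ∘ b, fun n _ => rfl⟩
    exact ⟨k, fun n hn => hk n hn⟩
  -- Only the values of `x'` off `C` matter; on `C` it follows `q k` to satisfy the clustering
  -- hypothesis.
  let x' : I → ZMod 2 := fun i => if i ∈ C then q k i else x i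
  have hx' : MapClusterPt x' atTop (Φ ∘ u k) := hq k x' fun i hi => by
    have : i ∈ C := Or.inr (mem_iUnion.2 ⟨k, hi⟩)
    simp [x', this]
  obtain ⟨n, hn, hnM⟩ := ((mapClusterPt_pi_discrete_iff.1 hx' (F.filter (· ∉ C))).and_eventually
    ((Filter.eventually_all_finset M).2 fun m _ => eventually_ne_atTop m)).exists
  have huM : ∀ m ∈ M, u k n m = x (b m) := by
    intro m hm
    simp [u, hk m hm, (hnM m hm).symm]
  refine ⟨_, hst ?_, ⟨⟨((k, n), fun i => Function.extend b (u k n) x i), fun m => by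
    simp [hb.extend_apply]⟩, rfl⟩⟩
  intro i hi
  suffices h : y _ i = x i by
    simp only [Function.comp_apply]
    rw [h]
    exact mem_of_mem_nhds (hs i)
  by_cases hiC : i ∈ C
  · simp only [y, hiC, dite_true]
    by_cases hib : ∃ m, b m = i
    · obtain ⟨m, rfl⟩ := hib
      rw [hb.extend_apply]
      exact huM m (by simpa [M] using hi)
    · exact Function.extend_apply' _ _ _ hib
  · have := hn i (by simpa [hiC] using hi)
    simpa [y, hiC, x'] using this

theorem exists_isClosed_not_separableSpace [Uncountable I] :
    ∃ K : AddSubgroup (almostGraph b Φ),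
      IsClosed (K : Set (almostGraph b Φ)) ∧ ¬ TopologicalSpace.SeparableSpace K := by
  classical
  let π : almostGraph b Φ →+ (ℕ → ZMod 2) :=
    { toFun := fun x => (x : I → ZMod 2) ∘ b
      map_zero' := rfl
      map_add' := fun _ _ => rfl }
  have hπ : Continuous π :=
    continuous_pi fun n => (continuous_apply (b n)).comp continuous_subtype_val
  refine ⟨π.ker, isClosed_singleton.preimage hπ, fun hsep => ?_⟩
  obtain ⟨s, hs, hd⟩ := TopologicalSpace.exists_countable_dense π.ker
  have hsupp : ∀ x : π.ker, {i | (x : I → ZMod 2) i ≠ 0}.Countable := by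
    intro x
    have h1 : (x : I → ZMod 2) ∘ b = 0 := x.2
    have h2 := mem_almostGraph.1 x.1.2
    simpa [h1] using h2
  have hcount : (range b ∪ ⋃ x ∈ s, {i | (x : I → ZMod 2) i ≠ 0}).Countable :=
    (countable_range b).union (hs.biUnion fun x _ => hsupp x)
  obtain ⟨i, hi⟩ := (Set.ne_univ_iff_exists_notMem (range b ∪ ⋃ x ∈ s, {i | (x : I → ZMod 2) i ≠ 0})).1
    fun h => not_countable_univ (h ▸ hcount)
  have hib : (Pi.single i 1 : I → ZMod 2) ∘ b = 0 := by
    ext n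
    have : b n ≠ i := fun h => hi (Or.inl ⟨n, h⟩)
    simp [this]
  have hmem : (Pi.single i 1 : I → ZMod 2) ∈ almostGraph b Φ := by
    rw [mem_almostGraph, hib]
    refine (countable_singleton i).mono fun j hj => ?_
    by_contra hji
    simp at hji
    simp [hji] at hj
  have hopen : IsOpen {x : π.ker | (x : I → ZMod 2) i ≠ 0} :=
    (isOpen_discrete {0}ᶜ).preimage
      ((continuous_apply i).comp (continuous_subtype_val.comp continuous_subtype_val))
  obtain ⟨x, hx, hxs⟩ := hd.inter_open_nonempty _ hopen ⟨⟨⟨_, hmem⟩, hib⟩, by simp⟩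
  exact hi (Or.inr (mem_biUnion hxs hx))

end

theorem exists_surjective_sequences (CH : Cardinal.continuum.{0} = Cardinal.aleph.{0} 1) :
    ∃ S : (Ordinal.omega.{0} 1).ToType → ℕ → (ℕ → ZMod 2), Function.Surjective S := by
  have h : Cardinal.mk (ℕ → (ℕ → ZMod 2)) ≤ Cardinal.mk (Ordinal.omega.{0} 1).ToType := by
    rw [Cardinal.mk_toType, Ordinal.card_omega, ← CH]
    simp
  obtain ⟨f⟩ := h
  exact ⟨Function.invFun f, Function.invFun_surjective f.injective⟩

theorem mainTheorem10 (CH : Cardinal.continuum.{0} = Cardinal.aleph.{0} 1) :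
    ∃ G : AddSubgroup ((Ordinal.omega.{0} 1).ToType → ZMod 2),
      TopologicalSpace.SeparableSpace G ∧ CountablyCompactSpace G ∧
        ∃ K : AddSubgroup G,
          IsClosed (K : Set G) ∧ ¬ TopologicalSpace.SeparableSpace K := by
  have hcard : Cardinal.mk (Ordinal.omega.{0} 1).ToType = Cardinal.aleph 1 := by
    rw [Cardinal.mk_toType, Ordinal.card_omega]
  have hunc : Uncountable (Ordinal.omega.{0} 1).ToType := by
    rw [← Cardinal.aleph0_lt_mk_iff, hcard]
    exact Cardinal.aleph0_lt_aleph_one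
  have hI : ∀ i : (Ordinal.omega.{0} 1).ToType, (Iio i).Countable := by
    intro i
    have := Cardinal.mk_Iio_lt i (by simp)
    rwa [hcard, Cardinal.lt_aleph_one_iff, Cardinal.le_aleph0_iff_set_countable] at this
  obtain ⟨S, hS⟩ := exists_surjective_sequences CH
  obtain ⟨Φ, hΦ⟩ := exists_addHom_mapClusterPt hI S hS
  let b := Infinite.natEmbedding (Ordinal.omega.{0} 1).ToType
  exact ⟨almostGraph b Φ, separableSpace_almostGraph b.injective hΦ,
    isCountablyCompact_iff_countablyCompactSpace.1 (isCountablyCompact_almostGraph hΦ),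
    exists_isClosed_not_separableSpace⟩
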